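/- For $\epsilon,\epsilon'\in\mathbb{R}$, $\zeta\in\mathbb{C}$ and $\tau\in\mathbb{C}$ with $\operatorname{Im}\tau>0$, let $$\theta\begin{bmatrix}\epsilon\\ \epsilon'\end{bmatrix}(\zeta,\tau)=\sum_{n\in\mathbb{Z}}\exp\left(2\pi i\left[\tfrac12\left(n+\tfrac{\epsilon}{2}\right)^2\tau+\left(n+\tfrac{\epsilon}{2}\right)\left(\zeta+\tfrac{\epsilon'}{2}\right)\right]\right),$$ and write $\theta\begin{bmatrix}\epsilon\\ \epsilon'\end{bmatrix}$ for its value at $\zeta=0$ and $\theta'\begin{bmatrix}\epsilon\\ \epsilon'\end{bmatrix}$ for its derivative with respect to $\zeta$ at $\zeta=0$. Put $\zeta_5=\exp(2\pi i/5)$. Theorem. For every $\tau$ with $\operatorname{Im}\tau>0$, the theta constants $\theta\begin{bmatrix}1/5\\ 1/5\end{bmatrix}$ and $\theta\begin{bmatrix}3/5\\ 3/5\end{bmatrix}$ are nonzero, and $$\frac{\theta'\begin{bmatrix}1/5\\ 1/5\end{bmatrix}}{\theta\begin{bmatrix}1/5\\ 1/5\end{bmatrix}}=\theta'\begin{bmatrix}1\\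 1\end{bmatrix}\,\frac{\theta^5\begin{bmatrix}1/5\\ 1/5\end{bmatrix}-3\zeta_5^4\,\theta^5\begin{bmatrix}3/5\\ 3/5\end{bmatrix}}{10\,\theta^3\begin{bmatrix}1/5\\ 1/5\end{bmatrix}\theta^3\begin{bmatrix}3/5\\ 3/5\end{bmatrix}},$$ $$\frac{\theta'\begin{bmatrix}3/5\\ 3/5\end{bmatrix}}{\theta\begin{bmatrix}3/5\\ 3/5\end{bmatrix}}=\theta'\begin{bmatrix}1\\ 1\end{bmatrix}\,\frac{3\,\theta^5\begin{bmatrix}1/5\\ 1/5\end{bmatrix}+\zeta_5^4\,\theta^5\begin{bmatrix}3/5\\ 3/5\end{bmatrix}}{10\,\theta^3\begin{bmatrix}1/5\\ 1/5\end{bmatrix}\theta^3\begin{bmatrix}3/5\\ 3/5\end{bmatrix}}.$$ -/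

import Mathlib

/-- The theta function with real characteristic `[ε; ε']`, as a function of `z` and `τ`. -/
noncomputable def thetaChar (ε ε' : ℝ) (z τ : ℂ) : ℂ :=
  ∑' n : ℤ, Complex.exp (2 * (Real.pi : ℂ) * Complex.I *
    ((1 / 2) * ((n : ℂ) + (ε : ℂ) / 2) ^ 2 * τ + ((n : ℂ) + (ε : ℂ) / 2) * (z + (ε' : ℂ) / 2)))

/-- The theta constant, that is, the value at `z = 0`. -/
noncomputable def thetaConst (ε ε' : ℝ) (τ : ℂ) : ℂ :=
  thetaChar ε ε' 0 τ

/-- The theta derivative, that is, the `z`-derivative at `z = 0`. -/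
noncomputable def thetaDeriv (ε ε' : ℝ) (τ : ℂ) : ℂ :=
  deriv (fun z : ℂ => thetaChar ε ε' z τ) 0

/-- The primitive `k`-th root of unity `exp (2πi / k)`. -/
noncomputable def rootZeta (k : ℕ) : ℂ :=
  Complex.exp (2 * (Real.pi : ℂ) * Complex.I / (k : ℂ))

/-- Comparison of the series with Mathlib's two-variable Jacobi theta function. -/
theorem thetaChar_eq (ε ε' : ℝ) (z τ : ℂ) :
    thetaChar ε ε' z τ =
      Complex.exp (2 * (Real.pi : ℂ) * Complex.I *
        ((ε : ℂ) ^ 2 / 8 * τ + (ε : ℂ) / 2 * (z + (ε' : ℂ) / 2))) *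
      jacobiTheta₂ (z + (ε' : ℂ) / 2 + (ε : ℂ) / 2 * τ) τ := by
  unfold thetaChar jacobiTheta₂
  rw [← tsum_mul_left]
  refine tsum_congr fun n => ?_
  rw [jacobiTheta₂_term, ← Complex.exp_add]
  congr 1
  ring

/-- On the upper half plane the defining series converges. -/
theorem summable_thetaChar (ε ε' : ℝ) (z : ℂ) {τ : ℂ} (hτ : 0 < τ.im) :
    Summable fun n : ℤ => Complex.exp (2 * (Real.pi : ℂ) * Complex.I *
      ((1 / 2) * ((n : ℂ) + (ε : ℂ) / 2) ^ 2 * τ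
        + ((n : ℂ) + (ε : ℂ) / 2) * (z + (ε' : ℂ) / 2))) := by
  refine ((hasSum_jacobiTheta₂_term (z + (ε' : ℂ) / 2 + (ε : ℂ) / 2 * τ) hτ).summable.mul_left
    (Complex.exp (2 * (Real.pi : ℂ) * Complex.I *
        ((ε : ℂ) ^ 2 / 8 * τ + (ε : ℂ) / 2 * (z + (ε' : ℂ) / 2))))).congr fun n => ?_
  rw [jacobiTheta₂_term, ← Complex.exp_add]
  congr 1
  ring

/-- For `τ` in the upper half plane the theta function is entire in `z`. -/
theorem differentiable_thetaChar (ε ε' : ℝ) {τ : ℂ} (hτ : 0 < τ.im) :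
    Differentiable ℂ fun z : ℂ => thetaChar ε ε' z τ := by
  intro z
  have h : DifferentiableAt ℂ (fun z : ℂ => jacobiTheta₂ (z + (ε' : ℂ) / 2 + (ε : ℂ) / 2 * τ) τ) z :=
    (differentiableAt_jacobiTheta₂_fst (z + (ε' : ℂ) / 2 + (ε : ℂ) / 2 * τ) hτ).comp
      (f := fun z : ℂ => z + (ε' : ℂ) / 2 + (ε : ℂ) / 2 * τ) z (by fun_prop)
  simp only [thetaChar_eq]
  exact DifferentiableAt.mul (by fun_prop) h

/-! Write f = θ[1;1](·,τ), an odd entire function, and w = (τ+1)/5. Up to exponential factors the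
two theta constants are f(2w) and f(w). Weierstrass' three-term relation for f
(`thetaChar_one_one_three_term`), differentiated at z = x, links the logarithmic derivatives of f at
x, x+y and x−y. Taking (x,y) = (w,2w) and (2w,w), and reducing 3w and 4w to −2w and −w modulo τ+1,
gives two linear equations in the two logarithmic derivatives (`log_deriv_relations`).

Non-vanishing needs no count of zeros: f(w) = 0 would make f(x+w)f(x−w)/f(x)² constant, hence f(x+w)
a constant times an exponential times f(x), which contradicts the behaviour under x ↦ x+1
(`thetaChar_one_one_ne_zero`). -/

/-! ### Addition formula and three-term relation -/

/-- Pairs of integers, split according to the parity of their sum. -/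
def intProdParityEquiv : (ℤ × ℤ) ⊕ (ℤ × ℤ) ≃ ℤ × ℤ where
  toFun := Sum.elim (fun p => (p.1 + p.2, p.1 - p.2)) (fun p => (p.1 + p.2, p.1 - p.2 - 1))
  invFun p := if (p.1 + p.2) % 2 = 0 then Sum.inl ((p.1 + p.2) / 2, (p.1 - p.2) / 2)
    else Sum.inr ((p.1 + p.2 + 1) / 2, (p.1 - p.2 - 1) / 2)
  left_inv := by
    rintro (⟨a, b⟩ | ⟨a, b⟩)
    · have h : (a + b + (a - b)) % 2 = 0 := by omega
      simp only [Sum.elim_inl, h, if_true, Sum.inl.injEq, Prod.mk.injEq]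
      omega
    · have h : ¬ (a + b + (a - b - 1)) % 2 = 0 := by omega
      simp only [Sum.elim_inr, h, if_false, Sum.inr.injEq, Prod.mk.injEq]
      omega
  right_inv := by
    rintro ⟨m, n⟩
    by_cases h : (m + n) % 2 = 0
    · simp only [h, if_true, Sum.elim_inl, Prod.mk.injEq]
      omega
    · simp only [h, if_false, Sum.elim_inr, Prod.mk.injEq]
      omega

theorem neg_exp_eq_exp (a : ℂ) : -Complex.exp a = Complex.exp (Real.pi * Complex.I + a) := by
  rw [Complex.exp_add, Complex.exp_pi_mul_I, neg_one_mul]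

/-- The addition formula expressing a product of odd theta functions by theta functions
of modulus `2τ`. -/
theorem thetaChar_one_one_mul (x y : ℂ) {τ : ℂ} (hτ : 0 < τ.im) :
    thetaChar 1 1 (x + y) τ * thetaChar 1 1 (x - y) τ =
      thetaChar 0 0 (2 * x) (2 * τ) * thetaChar 1 0 (2 * y) (2 * τ) -
        thetaChar 1 0 (2 * x) (2 * τ) * thetaChar 0 0 (2 * y) (2 * τ) := by
  have hτ2 : 0 < (2 * τ).im := by simpa using hτ
  have h10 := summable_mul_of_summable_norm (summable_thetaChar 1 0 (2 * x) hτ2).norm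
    (summable_thetaChar 0 0 (2 * y) hτ2).norm
  have h01 := summable_mul_of_summable_norm (summable_thetaChar 0 0 (2 * x) hτ2).norm
    (summable_thetaChar 1 0 (2 * y) hτ2).norm
  unfold thetaChar
  rw [tsum_mul_tsum_of_summable_norm (summable_thetaChar 1 1 (x + y) hτ).norm
      (summable_thetaChar 1 1 (x - y) hτ).norm,
    tsum_mul_tsum_of_summable_norm (summable_thetaChar 1 0 (2 * x) hτ2).norm
      (summable_thetaChar 0 0 (2 * y) hτ2).norm,
    tsum_mul_tsum_of_summable_norm (summable_thetaChar 0 0 (2 * x) hτ2).norm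
      (summable_thetaChar 1 0 (2 * y) hτ2).norm]
  -- The sign of a term is (−1)^(m+n+1): pairs with m+n even give the negative product, odd ones the
  -- positive.
  rw [← intProdParityEquiv.tsum_eq, sub_eq_neg_add _ (tsum _)]
  refine HasSum.tsum_eq (HasSum.sum ?_ ?_)
  · refine h10.hasSum.neg.congr_fun fun p => ?_
    simp only [Function.comp_apply, intProdParityEquiv, Equiv.coe_fn_mk, Sum.elim_inl]
    rw [← Complex.exp_add, ← Complex.exp_add, neg_exp_eq_exp, Complex.exp_eq_exp_iff_exists_int]
    refine ⟨p.1, ?_⟩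
    push_cast
    ring
  · refine h01.hasSum.congr_fun fun p => ?_
    simp only [Function.comp_apply, intProdParityEquiv, Equiv.coe_fn_mk, Sum.elim_inr]
    rw [← Complex.exp_add, ← Complex.exp_add, Complex.exp_eq_exp_iff_exists_int]
    refine ⟨p.1, ?_⟩
    push_cast
    ring

/-- Each product is a 2×2 determinant A(x)B(y) − B(x)A(y), so this is the Plücker relation for the
points x, y, z, 0. -/
theorem thetaChar_one_one_three_term (x y z : ℂ) {τ : ℂ} (hτ : 0 < τ.im) :
    thetaChar 1 1 (x + y) τ * thetaChar 1 1 (x - y) τ * thetaChar 1 1 z τ ^ 2 -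
      thetaChar 1 1 (x + z) τ * thetaChar 1 1 (x - z) τ * thetaChar 1 1 y τ ^ 2 +
      thetaChar 1 1 x τ ^ 2 * (thetaChar 1 1 (y + z) τ * thetaChar 1 1 (y - z) τ) = 0 := by
  have h (t : ℂ) : thetaChar 1 1 t τ ^ 2 = thetaChar 1 1 (t + 0) τ * thetaChar 1 1 (t - 0) τ := by
    rw [add_zero, sub_zero, sq]
  simp only [h, thetaChar_one_one_mul _ _ hτ]
  ring

/-! ### Oddness and quasi-periodicity -/

theorem thetaChar_one_one_neg (z τ : ℂ) : thetaChar 1 1 (-z) τ = -thetaChar 1 1 z τ := by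
  unfold thetaChar
  rw [← tsum_neg, ← ((Equiv.neg ℤ).trans (Equiv.subRight 1)).tsum_eq]
  refine tsum_congr fun n => ?_
  rw [neg_exp_eq_exp, Complex.exp_eq_exp_iff_exists_int]
  refine ⟨-n - 1, ?_⟩
  simp
  ring

/-- Quasi-periodicity of theta functions under translation by lattice points. -/
theorem thetaChar_add_lattice (ε ε' : ℝ) (z τ : ℂ) (a b : ℤ) :
    thetaChar ε ε' (z + a * τ + b) τ =
      Complex.exp (2 * (Real.pi : ℂ) * Complex.I *
        (ε * b / 2 - ε' * a / 2 - a * z - a ^ 2 * τ / 2)) * thetaChar ε ε' z τ := by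
  unfold thetaChar
  rw [← tsum_mul_left, ← (Equiv.subRight a).tsum_eq]
  refine tsum_congr fun n => ?_
  rw [← Complex.exp_add, Complex.exp_eq_exp_iff_exists_int]
  refine ⟨(n - a) * b, ?_⟩
  simp only [Equiv.subRight_apply]
  push_cast
  ring

/-! ### Non-vanishing at five-torsion points -/

/-- Integrating termwise over a period leaves only the zeroth Fourier coefficient, which is 1. -/
theorem exists_jacobiTheta₂_ne_zero {τ : ℂ} (hτ : 0 < τ.im) : ∃ z, jacobiTheta₂ z τ ≠ 0 := by
  by_contra! h
  have h1 : HasSum (fun n : ℤ => ∫ x : ℝ in (0 : ℝ)..1, jacobiTheta₂_term n x τ)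
      (∫ x : ℝ in (0 : ℝ)..1, jacobiTheta₂ x τ) := by
    refine intervalIntegral.hasSum_integral_of_dominated_convergence
      (fun n _ => ‖jacobiTheta₂_term n 0 τ‖) (fun n => ?_) (fun n => ?_) ?_ ?_ ?_
    · exact Continuous.aestronglyMeasurable (by unfold jacobiTheta₂_term; fun_prop)
    · exact .of_forall fun x _ => by simp [norm_jacobiTheta₂_term]
    · exact .of_forall fun x _ => (hasSum_jacobiTheta₂_term 0 hτ).summable.norm
    · simp
    · exact .of_forall fun x _ => hasSum_jacobiTheta₂_term x hτ
  have h2 : ∀ n : ℤ, n ≠ 0 → ∫ x : ℝ in (0 : ℝ)..1, jacobiTheta₂_term n x τ = 0 := by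
    intro n hn
    have hc : 2 * (Real.pi : ℂ) * Complex.I * n ≠ 0 := by
      simp [hn, Real.pi_ne_zero]
    simp only [jacobiTheta₂_term, Complex.exp_add]
    rw [intervalIntegral.integral_mul_const, integral_exp_mul_complex hc]
    have : Complex.exp (2 * (Real.pi : ℂ) * Complex.I * n) = 1 :=
      Complex.exp_eq_one_iff.2 ⟨n, by ring⟩
    simp [this]
  have h3 := h1.unique (hasSum_single 0 h2)
  simp [h, jacobiTheta₂_term] at h3

theorem exists_thetaChar_ne_zero (ε ε' : ℝ) {τ : ℂ} (hτ : 0 < τ.im) :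
    ∃ z, thetaChar ε ε' z τ ≠ 0 := by
  obtain ⟨z, hz⟩ := exists_jacobiTheta₂_ne_zero hτ
  refine ⟨z - ε' / 2 - ε / 2 * τ, ?_⟩
  rw [thetaChar_eq]
  refine mul_ne_zero (Complex.exp_ne_zero _) ?_
  rwa [show z - (ε' : ℂ) / 2 - ε / 2 * τ + ε' / 2 + ε / 2 * τ = z by ring]

theorem Differentiable.eq_zero_or_eq_zero_of_mul_eq_zero {f g : ℂ → ℂ} (hf : Differentiable ℂ f)
    (hg : Differentiable ℂ g) (hfg : ∀ z, f z * g z = 0) : (∀ z, f z = 0) ∨ ∀ z, g z = 0 := by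
  have h := AnalyticOnNhd.eq_zero_or_eq_zero_of_mul_eq_zero (U := Set.univ)
    (fun z _ => hf.analyticAt z) (fun z _ => hg.analyticAt z) (fun z _ => hfg z)
    isPreconnected_univ
  simpa using h

theorem Differentiable.exists_forall_eq_zero_of_prod_eq_zero {ι : Type*} (s : Finset ι)
    {f : ι → ℂ → ℂ} (hf : ∀ i, Differentiable ℂ (f i)) (h : ∀ z, ∏ i ∈ s, f i z = 0) :
    ∃ i ∈ s, ∀ z, f i z = 0 := by
  classical
  induction s using Finset.induction_on with
  | empty => simp at h
  | insert i s hi ih =>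
    simp only [Finset.prod_insert hi] at h
    rcases (hf i).eq_zero_or_eq_zero_of_mul_eq_zero
      (Differentiable.fun_finsetProd fun j _ => hf j) h with h | h
    · exact ⟨i, Finset.mem_insert_self i s, h⟩
    · obtain ⟨j, hj, hj0⟩ := ih h
      exact ⟨j, Finset.mem_insert_of_mem hj, hj0⟩

/-- Entire functions with equal `n`-th powers differ by a constant `n`-th root of unity. -/
theorem Differentiable.exists_eq_mul_of_pow_eq {f g : ℂ → ℂ} (hf : Differentiable ℂ f)
    (hg : Differentiable ℂ g) {n : ℕ} (hn : n ≠ 0) (h : ∀ z, f z ^ n = g z ^ n) :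
    ∃ c : ℂ, ∀ z, f z = c * g z := by
  -- Factor fⁿ − gⁿ over the n-th roots of unity; one factor must vanish identically.
  have hprod (z : ℂ) : ∏ c ∈ Polynomial.nthRootsFinset n (1 : ℂ), (f z - c * g z) = 0 := by
    rw [← (Complex.isPrimitiveRoot_exp n hn).pow_sub_pow_eq_prod_sub_mul _ _ (Nat.pos_of_ne_zero hn),
      h, sub_self]
  obtain ⟨c, -, hc⟩ := Differentiable.exists_forall_eq_zero_of_prod_eq_zero _
    (f := fun c z => f z - c * g z) (fun c => hf.sub (hg.const_mul c)) hprod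
  exact ⟨c, fun z => sub_eq_zero.1 (hc z)⟩

/-- Five consecutive terms of a sequence whose second multiplicative differences equal `c`. -/
theorem mul_pow_four_eq_of_mul_eq_mul_sq {K : Type*} [Field K] {c f₀ f₁ f₂ f₃ f₄ f₅ : K}
    (h₂ : f₂ * f₀ = c * f₁ ^ 2) (h₃ : f₃ * f₁ = c * f₂ ^ 2) (h₄ : f₄ * f₂ = c * f₃ ^ 2)
    (h₅ : f₅ * f₃ = c * f₄ ^ 2) (hf₀ : f₀ ≠ 0) (hf₁ : f₁ ≠ 0) (hf₂ : f₂ ≠ 0) (hf₃ : f₃ ≠ 0) :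
    f₅ * f₀ ^ 4 = c ^ 10 * f₁ ^ 5 := by
  have hc : c ≠ 0 := by
    rintro rfl
    exact mul_ne_zero hf₂ hf₀ (by simpa using h₂)
  have e₂ : f₂ = c * f₁ ^ 2 / f₀ := by rw [eq_div_iff hf₀, h₂]
  have e₃ : f₃ = c ^ 3 * f₁ ^ 3 / f₀ ^ 2 := by
    rw [eq_div_iff (by positivity)]
    apply mul_right_cancel₀ hf₁
    rw [mul_right_comm, h₃, e₂]
    field_simp
  have e₄ : f₄ = c ^ 6 * f₁ ^ 4 / f₀ ^ 3 := by
    apply mul_right_cancel₀ hf₂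
    rw [h₄, e₃, e₂]
    field_simp
  apply mul_right_cancel₀ hf₃
  rw [mul_right_comm, h₅, e₄, e₃]
  field_simp

/-- The odd theta function does not vanish at a point which is of exact order five modulo the
period lattice, here on the diagonal of the lattice. -/
theorem thetaChar_one_one_ne_zero {τ : ℂ} (hτ : 0 < τ.im) {w : ℂ} {a : ℤ} (ha : ¬ 5 ∣ a)
    (hw : 5 * w = a * τ + a) : thetaChar 1 1 w τ ≠ 0 := by
  intro hw0
  have hf := differentiable_thetaChar 1 1 hτ
  have hlat := fun z => thetaChar_add_lattice 1 1 z τ a a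
  have hone := fun z => thetaChar_add_lattice 1 1 z τ 0 1
  have h3 := fun x y => thetaChar_one_one_three_term x y w hτ
  obtain ⟨y, hy⟩ := exists_thetaChar_ne_zero 1 1 hτ
  generalize hF : (fun z => thetaChar 1 1 z τ) = f at hf
  have hF' : ∀ z, thetaChar 1 1 z τ = f z := fun z => congrFun hF z
  simp only [hF'] at hlat hone h3 hw0 hy
  -- With f(w) = 0 the first term of the three-term relation drops out and the variables separate.
  obtain ⟨c, hc⟩ : ∃ c, ∀ x, f (x + w) * f (x - w) = c * f x ^ 2 := by
    refine ⟨f (y + w) * f (y - w) / f y ^ 2, fun x => ?_⟩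
    have := h3 x y
    rw [hw0] at this
    field_simp
    linear_combination -this
  have hQ : ∀ x, f (x + 5 * w) * f x ^ 4 = c ^ 10 * f (x + w) ^ 5 := by
    have hs (t : ℂ) : Differentiable ℂ fun x => f (x + t) := hf.comp (by fun_prop)
    have hs0 (t : ℂ) : ¬ ∀ x, f (x + t) = 0 := fun h => hy (by simpa using h (y - t))
    -- The recursion divides by values of f; multiplying by them covers their zeros, and they cancel
    -- afterwards as nonzero entire functions.
    have key : ∀ x, (f (x + 0) * f (x + w) * f (x + 2 * w) * f (x + 3 * w)) *
        (f (x + 5 * w) * f x ^ 4 - c ^ 10 * f (x + w) ^ 5) = 0 := by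
      intro x
      by_contra hne
      simp only [mul_eq_zero, not_or, add_zero] at hne
      refine hne.2 (sub_eq_zero.2 (mul_pow_four_eq_of_mul_eq_mul_sq (f₄ := f (x + 4 * w))
        ?_ ?_ ?_ ?_ hne.1.1.1.1 hne.1.1.1.2 hne.1.1.2 hne.1.2))
      · convert hc (x + w) using 3 <;> ring
      · convert hc (x + 2 * w) using 3 <;> ring
      · convert hc (x + 3 * w) using 3 <;> ring
      · convert hc (x + 4 * w) using 3 <;> ring
    have d1 := hs 0
    have d2 := hs w
    have d3 := hs (2 * w)
    have d4 := hs (3 * w)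
    have d5 := hs (5 * w)
    rcases Differentiable.eq_zero_or_eq_zero_of_mul_eq_zero (by fun_prop) (by fun_prop) key
      with h | h
    · rcases Differentiable.eq_zero_or_eq_zero_of_mul_eq_zero (by fun_prop) (by fun_prop) h
        with h | h
      · rcases Differentiable.eq_zero_or_eq_zero_of_mul_eq_zero (by fun_prop) (by fun_prop) h
          with h | h
        · rcases Differentiable.eq_zero_or_eq_zero_of_mul_eq_zero (by fun_prop) (by fun_prop) h
            with h | h
          · exact absurd h (hs0 _)
          · exact absurd h (hs0 _)
        · exact absurd h (hs0 _)
      · exact absurd h (hs0 _)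
    · exact fun x => sub_eq_zero.1 (h x)
  have hQ' : ∀ x, Complex.exp (2 * (Real.pi : ℂ) * Complex.I * (-a * x - a ^ 2 * τ / 2)) *
      f x ^ 5 = c ^ 10 * f (x + w) ^ 5 := by
    intro x
    rw [← hQ, hw, ← add_assoc, hlat]
    have : ((1 : ℝ) : ℂ) * a / 2 - ((1 : ℝ) : ℂ) * a / 2 - a * x - a ^ 2 * τ / 2 =
      -a * x - a ^ 2 * τ / 2 := by ring
    rw [this]
    ring
  have hc0 : c ^ 10 ≠ 0 := by
    intro h
    have := hQ' y
    rw [h, zero_mul] at this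
    exact mul_ne_zero (Complex.exp_ne_zero _) (pow_ne_zero 5 hy) this
  obtain ⟨d, hd⟩ := IsAlgClosed.exists_pow_nat_eq (c ^ 10) (n := 5) (by norm_num)
  set g : ℂ → ℂ := fun x =>
    Complex.exp (2 * (Real.pi : ℂ) * Complex.I * ((-a * x - a ^ 2 * τ / 2) / 5)) with hg
  have hg0 : ∀ x, g x ≠ 0 := fun x => Complex.exp_ne_zero _
  have hgd : Differentiable ℂ g := by fun_prop
  obtain ⟨k, hk⟩ : ∃ k : ℂ, ∀ x, g x * f x = k * (d * f (x + w)) := by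
    refine Differentiable.exists_eq_mul_of_pow_eq (n := 5) (by fun_prop)
      ((hf.comp (by fun_prop : Differentiable ℂ fun x => x + w)).const_mul d) (by norm_num) fun x => ?_
    rw [mul_pow, mul_pow, hd, ← hQ', hg, ← Complex.exp_nat_mul]
    congr 2
    push_cast
    ring
  have hone' : ∀ x, f (x + 1) = -f x := by
    intro x
    have h := hone x
    have e : 2 * (Real.pi : ℂ) * Complex.I * (((1 : ℝ) : ℂ) * ((1 : ℤ) : ℂ) / 2 -
        ((1 : ℝ) : ℂ) * ((0 : ℤ) : ℂ) / 2 - ((0 : ℤ) : ℂ) * x - ((0 : ℤ) : ℂ) ^ 2 * τ / 2) =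
        Real.pi * Complex.I := by
      push_cast
      ring
    rw [e, Complex.exp_pi_mul_I] at h
    simpa using h
  -- Both translates of f change sign under x ↦ x+1, so g must not change; yet it is multiplied by
  -- exp(−2πia/5).
  have hgy : g (y + 1) = g y := by
    have h1 := hk (y + 1)
    rw [show y + 1 + w = y + w + 1 by ring, hone', hone'] at h1
    apply mul_right_cancel₀ hy
    rw [hk y]
    linear_combination -h1
  rw [hg, Complex.exp_eq_exp_iff_exists_int] at hgy
  obtain ⟨n, hn⟩ := hgy
  refine ha ⟨-n, ?_⟩
  have hpi : (2 * (Real.pi : ℂ) * Complex.I) ≠ 0 := Complex.two_pi_I_ne_zero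
  have : (a : ℂ) = 5 * (-n : ℂ) := by
    apply mul_left_cancel₀ hpi
    linear_combination -5 * hn
  exact_mod_cast this

/-! ### Logarithmic derivatives at five-torsion points -/

/-- The differentiated three-term relation for the odd theta function. -/
theorem deriv_thetaChar_one_one_relation (x y : ℂ) {τ : ℂ} (hτ : 0 < τ.im) :
    thetaChar 1 1 x τ ^ 2 *
        (deriv (fun z => thetaChar 1 1 z τ) (x + y) * thetaChar 1 1 (x - y) τ +
          thetaChar 1 1 (x + y) τ * deriv (fun z => thetaChar 1 1 z τ) (x - y)) =
      2 * thetaChar 1 1 x τ * deriv (fun z => thetaChar 1 1 z τ) x *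
          thetaChar 1 1 (x + y) τ * thetaChar 1 1 (x - y) τ +
        deriv (fun z => thetaChar 1 1 z τ) 0 * thetaChar 1 1 (2 * x) τ *
          thetaChar 1 1 y τ ^ 2 := by
  have hf := differentiable_thetaChar 1 1 hτ
  have h3 := fun z => thetaChar_one_one_three_term x y z hτ
  have hodd := fun z => thetaChar_one_one_neg z τ
  generalize hF : (fun z => thetaChar 1 1 z τ) = f at hf
  have hF' : ∀ z, thetaChar 1 1 z τ = f z := fun z => congrFun hF z
  simp only [hF'] at h3 hodd ⊢
  have hd : ∀ t, HasDerivAt f (deriv f t) t := fun t => (hf t).hasDerivAt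
  have hadd (t : ℂ) : HasDerivAt (fun z => f (t + z)) (deriv f (t + x)) x :=
    (hd (t + x)).comp_const_add t x
  have hsub (t : ℂ) : HasDerivAt (fun z => f (t - z)) (-deriv f (t - x)) x :=
    (hd (t - x)).comp_const_sub t x
  -- Differentiate in z at z = x, where f(x−z) vanishes and contributes only f′(0).
  have h := ((((hd x).pow 2).const_mul (f (x + y) * f (x - y))).sub
    (((hadd x).mul (hsub x)).mul_const (f y ^ 2))).add
    (((hadd y).mul (hsub y)).const_mul (f x ^ 2))
  have h0 := h.unique ((hasDerivAt_const x (0 : ℂ)).congr_of_eventuallyEq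
    (Filter.Eventually.of_forall h3))
  have hev : deriv f (y - x) = deriv f (x - y) := by
    have h1 := (hd (-(x - y))).comp (x - y) (hasDerivAt_neg (x - y))
    have h2 := h1.unique ((hd (x - y)).neg.congr_of_eventuallyEq (Filter.Eventually.of_forall hodd))
    rw [neg_sub] at h2
    linear_combination -h2
  have hz : f 0 = 0 := by
    have := hodd 0
    rw [neg_zero] at this
    exact self_eq_neg.1 this
  have hyx : f (y - x) = -f (x - y) := by rw [← hodd, neg_sub]
  rw [hev, hyx, sub_self, hz, ← two_mul, add_comm y x] at h0
  push_cast at h0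
  linear_combination -h0

theorem deriv_thetaChar_one_one_neg (z : ℂ) {τ : ℂ} (hτ : 0 < τ.im) :
    deriv (fun z => thetaChar 1 1 z τ) (-z) = deriv (fun z => thetaChar 1 1 z τ) z := by
  have h := ((differentiable_thetaChar 1 1 hτ (-z)).hasDerivAt.comp z (hasDerivAt_neg z)).unique
    ((differentiable_thetaChar 1 1 hτ z).hasDerivAt.neg.congr_of_eventuallyEq
      (Filter.Eventually.of_forall fun t => thetaChar_one_one_neg t τ))
  linear_combination -h

/-- The signs from the translations by τ and by 1 cancel, which makes the diagonal shift convenient.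
-/
theorem thetaChar_one_one_add_tau_add_one (z τ : ℂ) :
    thetaChar 1 1 (z + τ + 1) τ =
      Complex.exp (2 * (Real.pi : ℂ) * Complex.I * (-z - τ / 2)) * thetaChar 1 1 z τ := by
  have h := thetaChar_add_lattice 1 1 z τ 1 1
  push_cast at h
  rw [one_mul] at h
  rw [h]
  congr 3
  ring

theorem deriv_thetaChar_one_one_add_tau_add_one (z : ℂ) {τ : ℂ} (hτ : 0 < τ.im) :
    deriv (fun z => thetaChar 1 1 z τ) (z + τ + 1) =
      Complex.exp (2 * (Real.pi : ℂ) * Complex.I * (-z - τ / 2)) *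
        (deriv (fun z => thetaChar 1 1 z τ) z -
          2 * (Real.pi : ℂ) * Complex.I * thetaChar 1 1 z τ) := by
  have hd : ∀ t, HasDerivAt (fun z => thetaChar 1 1 z τ) (deriv (fun z => thetaChar 1 1 z τ) t) t :=
    fun t => (differentiable_thetaChar 1 1 hτ t).hasDerivAt
  have he : HasDerivAt
      (fun z : ℂ => Complex.exp (2 * (Real.pi : ℂ) * Complex.I * (-z - τ / 2)))
      (Complex.exp (2 * (Real.pi : ℂ) * Complex.I * (-z - τ / 2)) *
        (2 * (Real.pi : ℂ) * Complex.I * (-1))) z :=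
    (((hasDerivAt_neg z).sub_const (τ / 2)).const_mul _).cexp
  have h1 : HasDerivAt (fun z : ℂ => thetaChar 1 1 (z + τ + 1) τ) _ z :=
    (((hd (z + τ + 1)).comp_add_const (z + τ) 1).comp_add_const z τ)
  rw [h1.unique ((he.mul (hd z)).congr_of_eventuallyEq
    (Filter.Eventually.of_forall fun t => thetaChar_one_one_add_tau_add_one t τ))]
  ring

/-- Theta functions with arbitrary characteristic in terms of the odd theta function. -/
theorem thetaChar_eq_exp_mul_one_one (ε ε' : ℝ) (z τ : ℂ) :
    thetaChar ε ε' z τ =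
      Complex.exp (2 * (Real.pi : ℂ) * Complex.I * ((ε - 1) ^ 2 / 8 * τ + (ε - 1) / 2 * z +
        (ε - 1) * ε' / 4)) *
      thetaChar 1 1 (z + ((ε' - 1) / 2 + (ε - 1) / 2 * τ)) τ := by
  rw [thetaChar_eq, thetaChar_eq 1 1, ← mul_assoc, ← Complex.exp_add]
  congr 2
  · push_cast
    ring
  · push_cast
    ring

theorem thetaConst_eq_exp_mul_one_one (ε ε' : ℝ) (τ : ℂ) :
    thetaConst ε ε' τ =
      Complex.exp (2 * (Real.pi : ℂ) * Complex.I * ((ε - 1) ^ 2 / 8 * τ + (ε - 1) * ε' / 4)) *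
        -thetaChar 1 1 ((1 - ε') / 2 + (1 - ε) / 2 * τ) τ := by
  rw [thetaConst, thetaChar_eq_exp_mul_one_one, ← thetaChar_one_one_neg]
  congr 3
  · ring
  · ring

theorem thetaDeriv_eq_exp_mul_one_one (ε ε' : ℝ) {τ : ℂ} (hτ : 0 < τ.im) :
    thetaDeriv ε ε' τ =
      Complex.exp (2 * (Real.pi : ℂ) * Complex.I * ((ε - 1) ^ 2 / 8 * τ + (ε - 1) * ε' / 4)) *
        (deriv (fun z => thetaChar 1 1 z τ) ((1 - ε') / 2 + (1 - ε) / 2 * τ) +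
          Real.pi * Complex.I * (1 - ε) *
            thetaChar 1 1 ((1 - ε') / 2 + (1 - ε) / 2 * τ) τ) := by
  set p : ℂ := (1 - ε') / 2 + (1 - ε) / 2 * τ with hp
  have hq : ((ε' : ℂ) - 1) / 2 + (ε - 1) / 2 * τ = -p := by rw [hp]; ring
  have he : HasDerivAt (fun z : ℂ => Complex.exp (2 * (Real.pi : ℂ) * Complex.I *
      ((ε - 1) ^ 2 / 8 * τ + (ε - 1) / 2 * z + (ε - 1) * ε' / 4)))
      (Complex.exp (2 * (Real.pi : ℂ) * Complex.I *
        ((ε - 1) ^ 2 / 8 * τ + (ε - 1) / 2 * 0 + (ε - 1) * ε' / 4)) *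
        (2 * (Real.pi : ℂ) * Complex.I * ((ε - 1) / 2 * 1))) 0 :=
    (((((hasDerivAt_id (0 : ℂ)).const_mul _).const_add _).add_const _).const_mul _).cexp
  have hd : HasDerivAt (fun z : ℂ => thetaChar 1 1 (z + -p) τ)
      (deriv (fun z => thetaChar 1 1 z τ) (0 + -p)) 0 :=
    (differentiable_thetaChar 1 1 hτ (0 + -p)).hasDerivAt.comp_add_const 0 (-p)
  have h : HasDerivAt (fun z : ℂ => thetaChar ε ε' z τ) _ 0 := (he.mul hd).congr_of_eventuallyEq
    (Filter.Eventually.of_forall fun z => by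
      simp only [thetaChar_eq_exp_mul_one_one ε ε', hq, Pi.mul_apply])
  rw [thetaDeriv, h.deriv, zero_add, deriv_thetaChar_one_one_neg _ hτ, thetaChar_one_one_neg,
    mul_zero, add_zero]
  ring

/-- The algebra linking the two logarithmic derivatives: `F₁, F₂, D₁, D₂` are the values and
derivatives of the odd theta function at the two five-torsion points, `D₀` is its derivative at the
origin, and `a, b, e, e', ζ` are exponential factors. -/
theorem log_deriv_relations {a b e e' ζ F₁ F₂ D₀ D₁ D₂ c : ℂ} (ha : a ≠ 0) (hb : b ≠ 0)
    (he : e ≠ 0) (hF₁ : F₁ ≠ 0) (hF₂ : F₂ ≠ 0) (h₁ : a ^ 3 = -e * b ^ 2)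
    (h₂ : b ^ 3 * e' = ζ * a ^ 2 * e)
    (r₁ : F₁ ^ 2 * (e * (D₂ + 5 * c * F₂) * -F₁ + -(e * F₂) * D₁) =
      2 * F₁ * D₁ * -(e * F₂) * -F₁ + D₀ * F₂ * F₂ ^ 2)
    (r₂ : F₂ ^ 2 * (e * (D₂ + 5 * c * F₂) * F₁ + -(e * F₂) * D₁) =
      2 * F₂ * D₂ * -(e * F₂) * F₁ + D₀ * -(e' * F₁) * F₁ ^ 2) :
    b * (D₂ + 2 * c * F₂) / (b * -F₂) =
        D₀ * (((b * -F₂) ^ 5 - 3 * ζ * (a * -F₁) ^ 5) /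
          (10 * (b * -F₂) ^ 3 * (a * -F₁) ^ 3)) ∧
      a * (D₁ + c * F₁) / (a * -F₁) =
        D₀ * ((3 * (b * -F₂) ^ 5 + ζ * (a * -F₁) ^ 5) /
          (10 * (b * -F₂) ^ 3 * (a * -F₁) ^ 3)) := by
  have hu : a * (D₁ + c * F₁) / (a * -F₁) = -(D₁ / F₁ + c) := by field_simp
  have hv : b * (D₂ + 2 * c * F₂) / (b * -F₂) = -(D₂ / F₂ + 2 * c) := by field_simp
  -- The shifts add up to 2c + 3c here and 6c − c in `s₂`, both matching the quasi-period term 5c.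
  have s₁ : -(D₂ / F₂ + 2 * c) + 3 * -(D₁ / F₁ + c) = D₀ * (b * -F₂) ^ 2 / (a * -F₁) ^ 3 := by
    have : (a * -F₁) ^ 3 = e * b ^ 2 * F₁ ^ 3 := by linear_combination -F₁ ^ 3 * h₁
    rw [this]
    field_simp
    linear_combination r₁
  have s₂ : 3 * -(D₂ / F₂ + 2 * c) - -(D₁ / F₁ + c) =
      -ζ * D₀ * (a * -F₁) ^ 2 / (b * -F₂) ^ 3 := by
    have hζ : ζ = b ^ 3 * e' / (a ^ 2 * e) := by
      rw [eq_div_iff (by positivity)]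
      linear_combination -h₂
    rw [hζ]
    field_simp
    linear_combination -r₂
  rw [hu, hv]
  -- The system v + 3u = s₁, 3v − u = s₂ has solution v = (s₁ + 3s₂)/10, u = (3s₁ − s₂)/10.
  constructor
  · trans (D₀ * (b * -F₂) ^ 2 / (a * -F₁) ^ 3 +
      3 * (-ζ * D₀ * (a * -F₁) ^ 2 / (b * -F₂) ^ 3)) / 10
    · rw [← s₁, ← s₂]
      ring
    · field_simp
      ring
  · trans (3 * (D₀ * (b * -F₂) ^ 2 / (a * -F₁) ^ 3) -
      (-ζ * D₀ * (a * -F₁) ^ 2 / (b * -F₂) ^ 3)) / 10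
    · rw [← s₁, ← s₂]
      ring
    · field_simp
      ring

theorem mainTheorem2 (τ : ℂ) (hτ : 0 < τ.im) :
    thetaConst (1 / 5) (1 / 5) τ ≠ 0 ∧
    thetaConst (3 / 5) (3 / 5) τ ≠ 0 ∧
    thetaDeriv (1 / 5) (1 / 5) τ / thetaConst (1 / 5) (1 / 5) τ =
      thetaDeriv 1 1 τ *
        ((thetaConst (1 / 5) (1 / 5) τ ^ 5
            - 3 * rootZeta 5 ^ 4 * thetaConst (3 / 5) (3 / 5) τ ^ 5) /
          (10 * thetaConst (1 / 5) (1 / 5) τ ^ 3 * thetaConst (3 / 5) (3 / 5) τ ^ 3)) ∧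
    thetaDeriv (3 / 5) (3 / 5) τ / thetaConst (3 / 5) (3 / 5) τ =
      thetaDeriv 1 1 τ *
        ((3 * thetaConst (1 / 5) (1 / 5) τ ^ 5
            + rootZeta 5 ^ 4 * thetaConst (3 / 5) (3 / 5) τ ^ 5) /
          (10 * thetaConst (1 / 5) (1 / 5) τ ^ 3 * thetaConst (3 / 5) (3 / 5) τ ^ 3)) := by
  set w : ℂ := (τ + 1) / 5 with hw
  have e₁ := thetaConst_eq_exp_mul_one_one (1 / 5) (1 / 5) τ
  have e₃ := thetaConst_eq_exp_mul_one_one (3 / 5) (3 / 5) τ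
  have d₁ := thetaDeriv_eq_exp_mul_one_one (1 / 5) (1 / 5) hτ
  have d₃ := thetaDeriv_eq_exp_mul_one_one (3 / 5) (3 / 5) hτ
  push_cast at e₁ e₃ d₁ d₃
  have hp₁ : (1 - 1 / 5 : ℂ) / 2 + (1 - 1 / 5) / 2 * τ = 2 * w := by rw [hw]; ring
  have hp₃ : (1 - 3 / 5 : ℂ) / 2 + (1 - 3 / 5) / 2 * τ = w := by rw [hw]; ring
  rw [hp₁] at e₁ d₁
  rw [hp₃] at e₃ d₃
  have hF₁ : thetaChar 1 1 w τ ≠ 0 :=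
    thetaChar_one_one_ne_zero hτ (a := 1) (by norm_num) (by rw [hw]; push_cast; ring)
  have hF₂ : thetaChar 1 1 (2 * w) τ ≠ 0 :=
    thetaChar_one_one_ne_zero hτ (a := 2) (by norm_num) (by rw [hw]; push_cast; ring)
  have h3w : 3 * w = -(2 * w) + τ + 1 := by rw [hw]; ring
  have h4w : 2 * (2 * w) = -w + τ + 1 := by rw [hw]; ring
  have f3 : thetaChar 1 1 (3 * w) τ = _ := h3w ▸ thetaChar_one_one_add_tau_add_one _ _
  have f4 : thetaChar 1 1 (2 * (2 * w)) τ = _ := h4w ▸ thetaChar_one_one_add_tau_add_one _ _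
  have g3 : deriv (fun z => thetaChar 1 1 z τ) (3 * w) = _ :=
    h3w ▸ deriv_thetaChar_one_one_add_tau_add_one _ hτ
  rw [thetaChar_one_one_neg] at f3 f4 g3
  rw [deriv_thetaChar_one_one_neg _ hτ] at g3
  have r₁ := deriv_thetaChar_one_one_relation w (2 * w) hτ
  have r₂ := deriv_thetaChar_one_one_relation (2 * w) w hτ
  rw [show w + 2 * w = 3 * w by ring, show w - 2 * w = -w by ring, thetaChar_one_one_neg,
    deriv_thetaChar_one_one_neg _ hτ, f3, g3] at r₁
  rw [show 2 * w + w = 3 * w by ring, show 2 * w - w = w by ring, f3, g3, f4] at r₂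
  have hD₀ : thetaDeriv 1 1 τ = deriv (fun z => thetaChar 1 1 z τ) 0 := rfl
  have hζ : rootZeta 5 ^ 4 = Complex.exp (2 * (Real.pi : ℂ) * Complex.I * (4 / 5)) := by
    rw [rootZeta, ← Complex.exp_nat_mul]
    congr 1
    push_cast
    ring
  refine ⟨?_, ?_, ?_⟩
  · rw [e₁]
    exact mul_ne_zero (Complex.exp_ne_zero _) (neg_ne_zero.2 hF₂)
  · rw [e₃]
    exact mul_ne_zero (Complex.exp_ne_zero _) (neg_ne_zero.2 hF₁)
  have key := log_deriv_relations (c := 2 * Real.pi * Complex.I / 5)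
    (a := Complex.exp (2 * (Real.pi : ℂ) * Complex.I *
      ((3 / 5 - 1) ^ 2 / 8 * τ + (3 / 5 - 1) * (3 / 5) / 4)))
    (b := Complex.exp (2 * (Real.pi : ℂ) * Complex.I *
      ((1 / 5 - 1) ^ 2 / 8 * τ + (1 / 5 - 1) * (1 / 5) / 4)))
    (e := Complex.exp (2 * (Real.pi : ℂ) * Complex.I * (-(-(2 * w)) - τ / 2)))
    (e' := Complex.exp (2 * (Real.pi : ℂ) * Complex.I * (-(-w) - τ / 2)))
    (ζ := rootZeta 5 ^ 4) (D₀ := deriv (fun z => thetaChar 1 1 z τ) 0)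
    (D₁ := deriv (fun z => thetaChar 1 1 z τ) w) (D₂ := deriv (fun z => thetaChar 1 1 z τ) (2 * w))
    (Complex.exp_ne_zero _) (Complex.exp_ne_zero _) (Complex.exp_ne_zero _) hF₁ hF₂ ?_ ?_
    (by linear_combination r₁) (by linear_combination r₂)
  · rw [e₁, e₃, d₁, d₃, hD₀]
    refine ⟨?_, ?_⟩
    · convert key.1 using 3
      ring
    · convert key.2 using 3
      ring
  · rw [neg_mul, ← Complex.exp_nat_mul, ← Complex.exp_nat_mul, ← Complex.exp_add, neg_exp_eq_exp,
      Complex.exp_eq_exp_iff_exists_int]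
    refine ⟨-1, ?_⟩
    rw [hw]
    push_cast
    ring
  -- Here ζ₅⁴ arises: the constant phases are 2/25 and 4/5 + 7/25 = 27/25, one full turn apart.
  · rw [hζ, ← Complex.exp_nat_mul, ← Complex.exp_nat_mul, ← Complex.exp_add, ← Complex.exp_add,
      ← Complex.exp_add, Complex.exp_eq_exp_iff_exists_int]
    refine ⟨-1, ?_⟩
    rw [hw]
    push_cast
    ring
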